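/- Let $M\ge 2$, $p\ge 1$, $L\ge 1$ be integers and let $k,m\ge 0$ be integers. Then there exist integer constants $C_0,C_1>0$, depending only on $M,p,L,k,m$, such that the following holds. Let $A_j\in\mathbb R^{p\times p}$, $j\in\mathbb Z$, be matrices, all but finitely many equal to zero, and put $$(V\eta)(t)=\sum_{j\in\mathbb Z}A_j\,\eta(Mt-j)\qquad(\eta:\mathbb R\to\mathbb R^p).$$ Assume that $V$ preserves the support window $[0,L]$: $\operatorname{supp}(V\eta)\subset[0,L]$ for every continuous piecewise linear (CPwL) curve $\eta:\mathbb R\to\mathbb R^p$ with $\operatorname{supp}\eta\subset[0,L]$. Let $\gamma:\mathbb R\to\mathbb R^p$ be a CPwL curve with $\operatorname{supp}\gamma\subset[0,L]$ and at most $k$ breakpoints. For each $r\ge 0$ let $B_r:\mathbb R\to\mathbb R^p$ be a CPwL curve with $\operatorname{supp}B_r\subset[0,L]$ and at most $m$ breakpoints, and define $W_r\eta=V\eta+B_r$. Then $$W_{n-1}\cdots W_1W_0\,\gamma\in\Upsilon_{C_0,\,C_1n^2}(\operatorname{ReLU};1,p)\qquad\text{for all } n\ge 1 .$$ In particular, if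 $B:\mathbb R\to\mathbb R^p$ is a CPwL curve with $\operatorname{supp}B\subset[0,L]$ and at most $m$ breakpoints, and $W\eta=V\eta+B$, then $W^n\gamma\in\Upsilon_{C_0,\,C_1n^2}(\operatorname{ReLU};1,p)$ for all $n\ge1$, with the same constants. Here a breakpoint of a curve is a point having no neighbourhood on which the curve is affine, and a curve is CPwL if it is continuous and has finitely many breakpoints in every compact interval. $\Upsilon_{W,D}(\operatorname{ReLU};d,N)$ denotes the set of functions $\mathbb R^d\to\mathbb R^N$ that are outputs of fully connected ReLU networks with $D$ hidden layers of $W$ neurons each and an affine output layer (with arbitrary real weights and biases). -/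

import Mathlib

open Set Filter Topology

/-- The breakpoints of a curve: the points near which it is not affine. -/
def breakpoints {p : ℕ} (f : ℝ → Fin p → ℝ) : Set ℝ :=
  {t | ¬ ∃ c v : Fin p → ℝ, ∀ᶠ s in 𝓝 t, f s = c + s • v}

/-- Continuous piecewise linear curves: continuous, with finitely many breakpoints on every
compact interval. -/
def IsCPwL {p : ℕ} (f : ℝ → Fin p → ℝ) : Prop :=
  Continuous f ∧ ∀ a b : ℝ, (breakpoints f ∩ Icc a b).Finite

/-- CPwL curves supported in `[0, L]` with at most `m` breakpoints. -/
def IsWindowCurve {p : ℕ} (L m : ℕ) (f : ℝ → Fin p → ℝ) : Prop :=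
  IsCPwL f ∧ tsupport f ⊆ Icc (0 : ℝ) L ∧ (breakpoints f).encard ≤ m

/-- The homogeneous refinement operator `(V γ)(t) = ∑ j, A j (γ (M t - j))`, where all but finitely
many of the matrices `A j` vanish. -/
def refinementOp {p : ℕ} (M : ℕ) (A : ℤ →₀ Matrix (Fin p) (Fin p) ℝ) (γ : ℝ → Fin p → ℝ) :
    ℝ → Fin p → ℝ :=
  fun t => ∑ j ∈ A.support, (A j).mulVec (γ ((M : ℝ) * t - (j : ℝ)))

/-- `V` preserves the support window `[0, L]` of CPwL curves. -/
def PreservesWindow {p : ℕ} (M : ℕ) (A : ℤ →₀ Matrix (Fin p) (Fin p) ℝ) (L : ℕ) : Prop :=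
  ∀ γ : ℝ → Fin p → ℝ, IsCPwL γ → tsupport γ ⊆ Icc (0 : ℝ) L →
    tsupport (refinementOp M A γ) ⊆ Icc (0 : ℝ) L

/-- The affine rule `W γ = V γ + B`. -/
def forcedRefine {p : ℕ} (M : ℕ) (A : ℤ →₀ Matrix (Fin p) (Fin p) ℝ) (B γ : ℝ → Fin p → ℝ) :
    ℝ → Fin p → ℝ :=
  refinementOp M A γ + B

/-- `stageIterate W γ n = W (n - 1) (⋯ (W 1 (W 0 γ)))`. -/
def stageIterate {α : Type*} (W : ℕ → α → α) (γ : α) : ℕ → α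
  | 0 => γ
  | n + 1 => W n (stageIterate W γ n)

/-- A layer of ReLU neurons with weight matrix `A` and bias vector `b`. -/
def reluLayer {a c : ℕ} (A : Matrix (Fin c) (Fin a) ℝ) (b : Fin c → ℝ) (x : Fin a → ℝ) :
    Fin c → ℝ :=
  fun i => max ((A.mulVec x + b) i) 0

/-- `IsHiddenState d W ℓ H`: the map `H` sends an input in `ℝ^d` to the state of the `ℓ`-th hidden
layer of some fully connected ReLU network all of whose hidden layers have `W` neurons. -/
inductive IsHiddenState (d W : ℕ) : ℕ → ((Fin d → ℝ) → Fin W → ℝ) → Prop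
  | first (A : Matrix (Fin W) (Fin d) ℝ) (b : Fin W → ℝ) :
      IsHiddenState d W 1 (reluLayer A b)
  | next {l : ℕ} {H : (Fin d → ℝ) → Fin W → ℝ} (A : Matrix (Fin W) (Fin W) ℝ) (b : Fin W → ℝ) :
      IsHiddenState d W l H → IsHiddenState d W (l + 1) (fun x => reluLayer A b (H x))

/-- Outputs of fully connected ReLU networks with `L` hidden layers of width `W`, input dimension
`d` and output dimension `N`; the output layer is affine. -/
def Upsilon (W L d N : ℕ) : Set ((Fin d → ℝ) → Fin N → ℝ) :=
  {f | ∃ H, IsHiddenState d W L H ∧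
    ∃ (A : Matrix (Fin N) (Fin W) ℝ) (b : Fin N → ℝ), ∀ x, f x = A.mulVec (H x) + b}

/-!
Adding the initial curve as the forcing term of an extra first step, it suffices to treat the
curves `G 0 = 0`, `G (i + 1) = V (G i) + B i`. All of them are continuous piecewise linear and
supported in `[0, L]`, hence vanish off `(0, L)` and are Lipschitz.

The usual description of `V` by `M`-adic digits is discontinuous in the input, which a ReLU network
cannot reproduce exactly. Digits are therefore replaced by folding. The zigzag map `fold D` from
`[0, D]` to `[0, 1]` identifies points that differ by an even translation or a reflection at an
integer, and the vector of `sheets` of `G i` over `z ∈ [0, 1]` collects the values `G i (c + z)`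
and `G i (c - z)`. The sheets of `G (i + 1)` over `s` are linear combinations of values
`G i (c ± M s)`, plus values of `B i`. Each `G i (c ± M s)` is zero or one of the sheets of `G i`
over `fold M (M s)`; which one depends on the unit interval containing `M s`.

Choosing the sheet is the crux, and one layer of neurons does it exactly (`eq_add_sum_select`). At
an integer two neighbouring candidates agree, and since `G i` is Lipschitz their difference `Δ`
satisfies `|Δ| ≤ K |u|`, with `u` the signed distance to that integer. So
`max (K u + Δ) 0 - K max u 0` is `Δ` for `u ≥ 0` and `0` for `u ≤ 0`, and these terms telescope to
the correct candidate. The number of neurons depends on `M`, `p`, `L` and the number of breakpoints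
alone; the Lipschitz constants only enter the weights.

The network stores the input, projected to `[0, L]`. To pass from `G i` to `G (i + 1)` it recomputes
the required iterate of `s ↦ fold M (M s)` from the stored input in at most `n` layers, and then
applies one selection layer (`IsState.refine`). With `n` such steps the depth is quadratic in `n`.
-/

/-! ### Continuous piecewise linear curves -/

/-- The curve `f` coincides with an affine curve near `t`. -/
def IsAffineNear {p : ℕ} (f : ℝ → Fin p → ℝ) (t : ℝ) : Prop :=
  ∃ c v : Fin p → ℝ, ∀ᶠ s in 𝓝 t, f s = c + s • v

theorem notMem_breakpoints {p : ℕ} {f : ℝ → Fin p → ℝ} {t : ℝ} :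
    t ∉ breakpoints f ↔ IsAffineNear f t := by
  simp only [breakpoints, IsAffineNear, mem_ofPred_eq, not_not]

theorem IsAffineNear.zero {p : ℕ} (t : ℝ) : IsAffineNear (0 : ℝ → Fin p → ℝ) t :=
  ⟨0, 0, by simp⟩

theorem IsAffineNear.add {p : ℕ} {f g : ℝ → Fin p → ℝ} {t : ℝ}
    (hf : IsAffineNear f t) (hg : IsAffineNear g t) : IsAffineNear (f + g) t := by
  obtain ⟨c, v, hf⟩ := hf
  obtain ⟨c', v', hg⟩ := hg
  refine ⟨c + c', v + v', ?_⟩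
  filter_upwards [hf, hg] with s h h'
  rw [Pi.add_apply, h, h', smul_add]
  abel

theorem IsAffineNear.mulVec_comp {p : ℕ} {f : ℝ → Fin p → ℝ} (Q : Matrix (Fin p) (Fin p) ℝ)
    (a b t : ℝ) (hf : IsAffineNear f (a * t - b)) :
    IsAffineNear (fun s => Q.mulVec (f (a * s - b))) t := by
  obtain ⟨c, v, hf⟩ := hf
  have hcont : Tendsto (fun s : ℝ => a * s - b) (𝓝 t) (𝓝 (a * t - b)) :=
    Continuous.tendsto (by fun_prop) t
  refine ⟨Q.mulVec (c - b • v), Q.mulVec (a • v), ?_⟩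
  filter_upwards [hcont.eventually hf] with s hs
  rw [hs, ← Matrix.mulVec_smul, ← Matrix.mulVec_add]
  congr 1
  module

theorem isAffineNear_relu_smul {p : ℕ} (w : Fin p → ℝ) {b t : ℝ} (h : t ≠ b) :
    IsAffineNear (fun s => max (s - b) 0 • w) t := by
  rcases lt_or_gt_of_ne h with h | h
  · refine ⟨0, 0, ?_⟩
    filter_upwards [Iio_mem_nhds h] with s hs
    rw [max_eq_right (by linarith [mem_Iio.1 hs])]
    simp
  · refine ⟨-b • w, w, ?_⟩
    filter_upwards [Ioi_mem_nhds h] with s hs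
    rw [max_eq_left (by linarith [mem_Ioi.1 hs])]
    module

theorem exists_eq_affine_of_isPreconnected {p : ℕ} {f : ℝ → Fin p → ℝ} {I : Set ℝ}
    (hI : IsOpen I) (hc : IsPreconnected I) (h : ∀ t ∈ I, IsAffineNear f t) :
    ∃ c v : Fin p → ℝ, ∀ t ∈ I, f t = c + t • v := by
  have key : ∀ t ∈ I, DifferentiableAt ℝ f t ∧ HasDerivAt (deriv f) 0 t := by
    intro t ht
    obtain ⟨c, v, hf⟩ := h t ht
    have hd : ∀ s : ℝ, HasDerivAt (fun s : ℝ => c + s • v) v s := fun s => by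
      simpa using ((hasDerivAt_id s).smul_const v).const_add c
    refine ⟨((hd t).congr_of_eventuallyEq hf).differentiableAt, ?_⟩
    refine (hasDerivAt_const t v).congr_of_eventuallyEq ?_
    filter_upwards [eventually_eventually_nhds.2 hf] with s hs
    exact ((hd s).congr_of_eventuallyEq hs).deriv
  obtain ⟨v, hv⟩ := hI.exists_is_const_of_deriv_eq_zero hc
    (fun t ht => (key t ht).2.differentiableAt.differentiableWithinAt)
    (fun t ht => (key t ht).2.deriv)
  have hg : ∀ t ∈ I, HasDerivAt (fun s => f s - s • v) 0 t := by
    intro t ht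
    have := (key t ht).1.hasDerivAt.sub ((hasDerivAt_id t).smul_const v)
    rw [hv t ht, one_smul, sub_self] at this
    exact this
  obtain ⟨c, hc⟩ := hI.exists_is_const_of_deriv_eq_zero hc
    (fun t ht => (hg t ht).differentiableAt.differentiableWithinAt)
    (fun t ht => (hg t ht).deriv)
  exact ⟨c, v, fun t ht => by rw [← hc t ht]; abel⟩

/-- A kink at `b` can be removed by adding a multiple of `t ↦ max (t - b) 0`. -/
theorem exists_isAffineNear_add_relu {p : ℕ} {f : ℝ → Fin p → ℝ} (hf : Continuous f) {b : ℝ}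
    (h : ∀ᶠ t in 𝓝[≠] b, IsAffineNear f t) :
    ∃ w : Fin p → ℝ, IsAffineNear (fun t => f t + max (t - b) 0 • w) b := by
  obtain ⟨δ, hδ, hball⟩ := Metric.mem_nhdsWithin_iff.1 h
  have hoff : ∀ t, t ≠ b → b - δ < t → t < b + δ → IsAffineNear f t := fun t ht h1 h2 =>
    hball ⟨by rw [Metric.mem_ball, Real.dist_eq, abs_lt]; constructor <;> linarith, ht⟩
  obtain ⟨c₁, v₁, h₁⟩ := exists_eq_affine_of_isPreconnected (f := f) isOpen_Ioo
    (isPreconnected_Ioo (a := b - δ) (b := b))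
    (fun t ht => hoff t ht.2.ne ht.1 (by linarith [ht.2]))
  obtain ⟨c₂, v₂, h₂⟩ := exists_eq_affine_of_isPreconnected (f := f) isOpen_Ioo
    (isPreconnected_Ioo (a := b) (b := b + δ))
    (fun t ht => hoff t ht.1.ne' (by linarith [ht.1]) ht.2)
  have hb₁ : f b = c₁ + b • v₁ := by
    have : EqOn f (fun t => c₁ + t • v₁) (Ioo (b - δ) b) := h₁
    refine this.closure hf (by fun_prop) ?_
    rw [closure_Ioo (by linarith)]
    constructor <;> linarith
  have hb₂ : f b = c₂ + b • v₂ := by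
    have : EqOn f (fun t => c₂ + t • v₂) (Ioo b (b + δ)) := h₂
    refine this.closure hf (by fun_prop) ?_
    rw [closure_Ioo (by linarith)]
    constructor <;> linarith
  refine ⟨v₁ - v₂, c₁, v₁, ?_⟩
  filter_upwards [Ioo_mem_nhds (show b - δ < b by linarith) (show b < b + δ by linarith)]
    with s hs
  rcases lt_trichotomy s b with hsb | rfl | hsb
  · rw [max_eq_right (by linarith), h₁ s ⟨hs.1, hsb⟩]
    simp
  · simp [hb₁]
  · rw [max_eq_left (by linarith), h₂ s ⟨hsb, hs.2⟩]
    have hc : c₂ = c₁ + b • v₁ - b • v₂ := by rw [← hb₁, hb₂]; abel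
    rw [hc]
    module

/-- A continuous curve that is affine near every point outside the finite set `S` is an affine
curve plus a combination of the hinges `t ↦ max (t - b) 0`, `b ∈ S`. -/
theorem exists_eq_sum_relu {p : ℕ} (S : Finset ℝ) {f : ℝ → Fin p → ℝ} (hf : Continuous f)
    (h : ∀ t, t ∉ S → IsAffineNear f t) :
    ∃ (c v : Fin p → ℝ) (w : ℝ → Fin p → ℝ), ∀ t,
      f t = c + t • v + ∑ b ∈ S, max (t - b) 0 • w b := by
  classical
  induction S using Finset.induction_on generalizing f with
  | empty =>
    obtain ⟨c, v, hcv⟩ := exists_eq_affine_of_isPreconnected (f := f) isOpen_univ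
      isPreconnected_univ (fun t _ => h t (by simp))
    exact ⟨c, v, 0, fun t => by simp [hcv t]⟩
  | insert b S hbS ih =>
    have hev : ∀ᶠ t in 𝓝[≠] b, IsAffineNear f t := by
      have hS : ∀ᶠ t in 𝓝 b, t ∉ S :=
        (S.finite_toSet.isClosed.isOpen_compl).mem_nhds (by simpa using hbS)
      filter_upwards [self_mem_nhdsWithin, mem_nhdsWithin_of_mem_nhds hS] with t ht ht'
      exact h t (by simpa [ht'] using ht)
    obtain ⟨w₀, hw₀⟩ := exists_isAffineNear_add_relu hf hev
    obtain ⟨c, v, w, hw⟩ := ih (f := fun t => f t + max (t - b) 0 • w₀) (by fun_prop) (by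
      intro t ht
      by_cases htb : t = b
      · rwa [htb]
      · exact (h t (by simp [ht, htb])).add (isAffineNear_relu_smul w₀ htb))
    refine ⟨c, v, Function.update w b (-w₀), fun t => ?_⟩
    rw [Finset.sum_insert hbS, Finset.sum_congr rfl (fun x hx => by
      rw [Function.update_of_ne (ne_of_mem_of_not_mem hx hbS)])]
    rw [Function.update_self, eq_sub_of_add_eq (hw t)]
    module

/-- CPwL curves supported in `[0, L]`, without a bound on the number of breakpoints. -/
def IsSupportedCPwL {p : ℕ} (L : ℕ) (f : ℝ → Fin p → ℝ) : Prop :=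
  IsCPwL f ∧ tsupport f ⊆ Icc (0 : ℝ) L

theorem IsSupportedCPwL.zero {p : ℕ} (L : ℕ) : IsSupportedCPwL L (0 : ℝ → Fin p → ℝ) := by
  refine ⟨⟨continuous_zero, fun a b => ?_⟩, by simp⟩
  have : breakpoints (0 : ℝ → Fin p → ℝ) = ∅ :=
    eq_empty_of_forall_notMem fun t => notMem_breakpoints.2 (IsAffineNear.zero t)
  simp [this]

theorem IsCPwL.add {p : ℕ} {f g : ℝ → Fin p → ℝ} (hf : IsCPwL f) (hg : IsCPwL g) :
    IsCPwL (f + g) := by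
  refine ⟨hf.1.add hg.1, fun a b => ((hf.2 a b).union (hg.2 a b)).subset ?_⟩
  rintro t ⟨ht, hab⟩
  by_contra hcon
  rw [← union_inter_distrib_right, mem_inter_iff, not_and_or, mem_union, not_or] at hcon
  rcases hcon with ⟨h1, h2⟩ | h
  · exact notMem_breakpoints.2 ((notMem_breakpoints.1 h1).add (notMem_breakpoints.1 h2)) ht
  · exact h hab

theorem IsCPwL.mulVec_comp {p : ℕ} {f : ℝ → Fin p → ℝ} (hf : IsCPwL f)
    (Q : Matrix (Fin p) (Fin p) ℝ) {a : ℝ} (ha : 0 < a) (b : ℝ) :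
    IsCPwL (fun s => Q.mulVec (f (a * s - b))) := by
  have hfc := hf.1
  refine ⟨?_, fun x y => ?_⟩
  · exact Continuous.matrix_mulVec continuous_const (hfc.comp (by fun_prop))
  · have hinj : Function.Injective (fun s : ℝ => a * s - b) := fun s t h => by
      have h' : a * s - b = a * t - b := h
      exact mul_left_cancel₀ ha.ne' (by linarith)
    refine ((hf.2 (a * x - b) (a * y - b)).preimage hinj.injOn).subset ?_
    rintro t ⟨ht, htx, hty⟩
    refine ⟨?_, ?_, ?_⟩
    · by_contra hcon
      exact notMem_breakpoints.2 ((notMem_breakpoints.1 hcon).mulVec_comp Q a b t) ht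
    · nlinarith
    · nlinarith

theorem isCPwL_refinementOp {p M : ℕ} (hM : 0 < M) (A : ℤ →₀ Matrix (Fin p) (Fin p) ℝ)
    {f : ℝ → Fin p → ℝ} (hf : IsCPwL f) : IsCPwL (refinementOp M A f) := by
  have : refinementOp M A f =
      ∑ j ∈ A.support, fun t => (A j).mulVec (f ((M : ℝ) * t - (j : ℝ))) := by
    ext t i
    simp [refinementOp]
  rw [this]
  refine Finset.sum_induction _ IsCPwL (fun _ _ => IsCPwL.add) (IsSupportedCPwL.zero 0).1
    fun j _ => hf.mulVec_comp (A j) (by exact_mod_cast hM) j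

theorem isSupportedCPwL_forcedRefine {p M L : ℕ} (hM : 0 < M)
    {A : ℤ →₀ Matrix (Fin p) (Fin p) ℝ} (hA : PreservesWindow M A L) {B f : ℝ → Fin p → ℝ}
    (hB : IsSupportedCPwL L B) (hf : IsSupportedCPwL L f) :
    IsSupportedCPwL L (forcedRefine M A B f) :=
  ⟨(isCPwL_refinementOp hM A hf.1).add hB.1,
    (tsupport_add _ _).trans (union_subset (hA f hf.1 hf.2) hB.2)⟩

theorem IsSupportedCPwL.eq_zero {p L : ℕ} {f : ℝ → Fin p → ℝ} (hf : IsSupportedCPwL L f) {t : ℝ}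
    (ht : t ≤ 0 ∨ (L : ℝ) ≤ t) : f t = 0 := by
  have hout : ∀ s ∈ (Icc (0 : ℝ) L)ᶜ, f s = 0 := fun s hs =>
    image_eq_zero_of_notMem_tsupport fun h => hs (hf.2 h)
  rcases ht with ht | ht
  · have : EqOn f 0 (Iio 0) := fun s hs => hout s fun h => absurd h.1 (not_le.2 hs)
    exact this.closure hf.1.1 continuous_zero (by rwa [closure_Iio])
  · have : EqOn f 0 (Ioi (L : ℝ)) := fun s hs => hout s fun h => absurd h.2 (not_le.2 hs)
    exact this.closure hf.1.1 continuous_zero (by rwa [closure_Ioi])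

theorem IsSupportedCPwL.breakpoints_finite {p L : ℕ} {f : ℝ → Fin p → ℝ}
    (hf : IsSupportedCPwL L f) : (breakpoints f).Finite := by
  refine (hf.1.2 0 L).subset fun t ht => ⟨ht, ?_⟩
  by_contra hcon
  refine notMem_breakpoints.2 ⟨0, 0, ?_⟩ ht
  filter_upwards [notMem_tsupport_iff_eventuallyEq.1 fun h => hcon (hf.2 h)] with s hs
  simpa using hs

theorem IsSupportedCPwL.exists_lipschitz {p L : ℕ} {f : ℝ → Fin p → ℝ}
    (hf : IsSupportedCPwL L f) (i : Fin p) :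
    ∃ K : ℝ, 0 ≤ K ∧ ∀ s t, |f s i - f t i| ≤ K * |s - t| := by
  obtain ⟨c, v, w, hw⟩ := exists_eq_sum_relu hf.breakpoints_finite.toFinset hf.1.1
    (fun t ht => notMem_breakpoints.1 (by simpa using ht))
  refine ⟨|v i| + ∑ b ∈ hf.breakpoints_finite.toFinset, |w b i|, by positivity, fun s t => ?_⟩
  have : f s i - f t i = (s - t) * v i + ∑ b ∈ hf.breakpoints_finite.toFinset,
      (max (s - b) 0 - max (t - b) 0) * w b i := by
    rw [hw s, hw t]
    simp only [Pi.add_apply, Pi.smul_apply, smul_eq_mul, Finset.sum_apply, sub_mul,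
      Finset.sum_sub_distrib]
    ring
  rw [this, add_mul, Finset.sum_mul]
  refine (abs_add_le _ _).trans (add_le_add (by rw [abs_mul, mul_comm]) ?_)
  refine (Finset.abs_sum_le_sum_abs _ _).trans (Finset.sum_le_sum fun b _ => ?_)
  rw [abs_mul, mul_comm]
  refine mul_le_mul_of_nonneg_left ?_ (abs_nonneg _)
  simpa using abs_max_sub_max_le_abs (s - b) (t - b) 0

/-! ### Folding and selection -/

/-- The zigzag map `[0, D] → [0, 1]` with slopes alternately `1` and `-1` on the unit intervals,
written as a combination of `D` hinges. -/
noncomputable def fold (D : ℕ) (x : ℝ) : ℝ :=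
  ∑ d ∈ Finset.range D, (if d = 0 then 1 else 2 * (-1) ^ d) * max (x - d) 0

/-- The inverse of the branch of `fold` over `[d, d + 1]`. -/
noncomputable def unfoldBranch (d : ℕ) (z : ℝ) : ℝ :=
  if Even d then d + z else d + 1 - z

theorem exists_nat_mem_unit_interval {D : ℕ} (hD : 1 ≤ D) {x : ℝ} (h0 : 0 ≤ x) (hx : x ≤ D) :
    ∃ e : ℕ, e < D ∧ (e : ℝ) ≤ x ∧ x ≤ e + 1 := by
  rcases hx.lt_or_eq with h | h
  · exact ⟨⌊x⌋₊, (Nat.floor_lt h0).2 h, Nat.floor_le h0, (Nat.lt_floor_add_one x).le⟩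
  · refine ⟨D - 1, by omega, ?_, ?_⟩ <;> rw [Nat.cast_sub hD, h] <;> simp

theorem sum_range_eq_of_forall_ge {D e : ℕ} (he : e ≤ D) (a : ℕ → ℝ)
    (h : ∀ d, e ≤ d → a d = 0) : ∑ d ∈ Finset.range D, a d = ∑ d ∈ Finset.range e, a d :=
  (Finset.sum_subset (Finset.range_mono he) fun d _ hd => h d (by simpa using hd)).symm

theorem fold_eq {D e : ℕ} (he : e < D) {x : ℝ} (h1 : (e : ℝ) ≤ x) (h2 : x ≤ e + 1) :
    fold D x = if Even e then x - e else e + 1 - x := by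
  rw [fold, sum_range_eq_of_forall_ge (Nat.succ_le_of_lt he)]
  · rw [Finset.sum_congr rfl (g := fun d : ℕ =>
      (if d = 0 then (1 : ℝ) else 2 * (-1) ^ d) * (x - d)) fun d hd => by
      have : (d : ℝ) ≤ e := by exact_mod_cast Finset.mem_range_succ_iff.1 hd
      rw [max_eq_left (by linarith)]]
    clear h1 h2 he
    induction e with
    | zero => simp
    | succ e ih =>
      rw [Finset.sum_range_succ, ih, if_neg (Nat.succ_ne_zero e)]
      by_cases hev : Even e
      · rw [if_pos hev, if_neg (by simpa [Nat.even_add_one] using hev), Odd.neg_one_pow hev.add_one]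
        push_cast
        ring
      · rw [if_neg hev, if_pos (by simpa [Nat.even_add_one] using hev),
          Even.neg_one_pow (by simpa [Nat.even_add_one] using hev)]
        push_cast
        ring
  · intro d hd
    have : (e : ℝ) + 1 ≤ d := by exact_mod_cast hd
    rw [max_eq_right (by linarith), mul_zero]

theorem unfoldBranch_fold {D e : ℕ} (he : e < D) {x : ℝ} (h1 : (e : ℝ) ≤ x) (h2 : x ≤ e + 1) :
    unfoldBranch e (fold D x) = x := by
  rw [fold_eq he h1 h2, unfoldBranch]
  split_ifs <;> ring

theorem fold_mem {D : ℕ} (hD : 1 ≤ D) {x : ℝ} (hx : x ∈ Icc (0 : ℝ) D) :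
    fold D x ∈ Icc (0 : ℝ) 1 := by
  obtain ⟨e, he, h1, h2⟩ := exists_nat_mem_unit_interval hD hx.1 hx.2
  rw [fold_eq he h1 h2]
  split_ifs <;> constructor <;> linarith

/-- Adjacent branches of the inverse of `fold` agree at their common end `d + 1`, and separate at
most linearly. -/
theorem abs_unfoldBranch_succ_sub_le {D : ℕ} (hD : 1 ≤ D) {x : ℝ}
    (hx : x ∈ Icc (0 : ℝ) D) (d : ℕ) :
    |unfoldBranch (d + 1) (fold D x) - unfoldBranch d (fold D x)| ≤ 2 * |x - (d + 1)| := by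
  obtain ⟨e, he, h1, h2⟩ := exists_nat_mem_unit_interval hD hx.1 hx.2
  rw [fold_eq he h1 h2, unfoldBranch, unfoldBranch]
  have hpar : Even (d + 1) ↔ ¬ Even d := Nat.even_add_one
  have hcmp : (d + 2 ≤ e ∨ d + 1 = e) ∨ (d = e ∨ e + 1 ≤ d) := by omega
  have habs := abs_nonneg (x - (d + 1))
  rcases hcmp with (h | h) | (h | h)
  · have h' : (d : ℝ) + 2 ≤ e := by exact_mod_cast h
    rw [abs_of_nonneg (show 0 ≤ x - (d + 1) by linarith)]
    split_ifs <;> first | tauto | (push_cast; rw [abs_le]; constructor <;> linarith)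
  · subst h
    push_cast at h1 h2
    rw [abs_of_nonneg (show 0 ≤ x - (d + 1) by linarith)]
    split_ifs <;> first | tauto | (push_cast; rw [abs_le]; constructor <;> linarith)
  · subst h
    rw [abs_of_nonpos (show x - (d + 1) ≤ 0 by linarith)]
    split_ifs <;> first | tauto | (push_cast; rw [abs_le]; constructor <;> linarith)
  · have h' : (e : ℝ) + 1 ≤ d := by exact_mod_cast h
    rw [abs_of_nonpos (show x - (d + 1) ≤ 0 by linarith)]
    split_ifs <;> first | tauto | (push_cast; rw [abs_le]; constructor <;> linarith)

/-- Exact selection of the active branch by one layer of ReLU neurons: the value `φ x` is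
recovered from `x` and the values of `φ` at all the points of `[0, D]` that `fold D` identifies
with `x`. Since `φ` is Lipschitz, the difference `Δ` of the values over two adjacent branches
satisfies `|Δ| ≤ 2 K |u|`, where `u` is the signed distance of `x` from the common end of
the branches, so that `max (2 K u + Δ) 0 - 2 K max u 0` is `Δ` for `u ≥ 0` and `0` for
`u ≤ 0`. -/
theorem eq_add_sum_select {φ : ℝ → ℝ} {K : ℝ} (hK : 0 ≤ K)
    (hφ : ∀ s t, |φ s - φ t| ≤ K * |s - t|) {D : ℕ} (hD : 1 ≤ D) {x : ℝ}
    (hx : x ∈ Icc (0 : ℝ) D) :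
    φ x = φ (unfoldBranch 0 (fold D x)) + ∑ d ∈ Finset.range (D - 1),
      (max (2 * K * (x - (d + 1)) +
          (φ (unfoldBranch (d + 1) (fold D x)) - φ (unfoldBranch d (fold D x)))) 0
        + -(2 * K) * max (x - (d + 1)) 0) := by
  obtain ⟨e, he, h1, h2⟩ := exists_nat_mem_unit_interval hD hx.1 hx.2
  have hcone : ∀ d : ℕ, |φ (unfoldBranch (d + 1) (fold D x)) - φ (unfoldBranch d (fold D x))| ≤
      2 * K * |x - (d + 1)| := fun d => by
    refine (hφ _ _).trans ?_
    have := mul_le_mul_of_nonneg_left (abs_unfoldBranch_succ_sub_le hD hx d) hK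
    linarith
  rw [sum_range_eq_of_forall_ge (e := e) (by omega)]
  · rw [Finset.sum_congr rfl
      (g := fun d : ℕ => φ (unfoldBranch (d + 1) (fold D x)) - φ (unfoldBranch d (fold D x)))
        fun d hd => ?_,
      Finset.sum_range_sub (fun d : ℕ => φ (unfoldBranch d (fold D x))),
      unfoldBranch_fold he h1 h2]
    · ring
    have hde : (d : ℝ) + 1 ≤ e := by exact_mod_cast Finset.mem_range.1 hd
    have hc := hcone d
    have hu : 0 ≤ x - (d + 1) := by linarith
    rw [abs_of_nonneg hu, abs_le] at hc
    rw [max_eq_left (by linarith), max_eq_left hu]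
    ring
  · intro d hd
    have hde : (e : ℝ) ≤ d := by exact_mod_cast hd
    have hc := hcone d
    have hu : x - (d + 1) ≤ 0 := by linarith
    rw [abs_of_nonpos hu, abs_le] at hc
    rw [max_eq_right (by linarith), max_eq_right hu]
    ring

/-! ### Scalar functions computed by one layer of neurons -/

/-- The scalar function `g` of the network input is an affine function of the state `f`. -/
def IsAffineIn {ι : Type} [Fintype ι] (f : ℝ → ι → ℝ) (g : ℝ → ℝ) : Prop :=
  ∃ (q : ι → ℝ) (b : ℝ), ∀ t, g t = q ⬝ᵥ f t + b

/-- The scalar function `g` of the network input is, up to an additive constant, a linear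
combination of at most `w` ReLU neurons fed with the state `f`. -/
def IsNeuronSum {ι : Type} [Fintype ι] (f : ℝ → ι → ℝ) (w : ℕ) (g : ℝ → ℝ) : Prop :=
  ∃ (κ : Type) (_ : Fintype κ) (q : κ → ι → ℝ) (b c : κ → ℝ) (e : ℝ), Fintype.card κ ≤ w ∧
    ∀ t, g t = ∑ k, c k * max (q k ⬝ᵥ f t + b k) 0 + e

section OneLayer

variable {ι : Type} [Fintype ι] {f : ℝ → ι → ℝ} {g h : ℝ → ℝ} {w w' : ℕ}

theorem isAffineIn_coord (f : ℝ → ι → ℝ) (i : ι) : IsAffineIn f (fun t => f t i) := by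
  classical
  exact ⟨Pi.single i 1, 0, fun t => by simp⟩

theorem isAffineIn_const (f : ℝ → ι → ℝ) (b : ℝ) : IsAffineIn f (fun _ => b) :=
  ⟨0, b, fun t => by simp⟩

theorem IsAffineIn.add (hg : IsAffineIn f g) (hh : IsAffineIn f h) :
    IsAffineIn f (fun t => g t + h t) := by
  obtain ⟨q, b, hg⟩ := hg
  obtain ⟨q', b', hh⟩ := hh
  exact ⟨q + q', b + b', fun t => by
    beta_reduce; rw [hg, hh, add_dotProduct]; ring⟩

theorem IsAffineIn.const_mul (a : ℝ) (hg : IsAffineIn f g) : IsAffineIn f (fun t => a * g t) := by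
  obtain ⟨q, b, hg⟩ := hg
  exact ⟨a • q, a * b, fun t => by
    beta_reduce; rw [hg, smul_dotProduct, smul_eq_mul]; ring⟩

theorem IsAffineIn.sub (hg : IsAffineIn f g) (hh : IsAffineIn f h) :
    IsAffineIn f (fun t => g t - h t) := by
  simpa [sub_eq_add_neg] using hg.add (hh.const_mul (-1))

theorem IsAffineIn.relu (hg : IsAffineIn f g) : IsNeuronSum f 1 (fun t => max (g t) 0) := by
  obtain ⟨q, b, hg⟩ := hg
  exact ⟨Unit, inferInstance, fun _ => q, fun _ => b, fun _ => 1, 0, by simp,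
    fun t => by simp [hg]⟩

theorem isNeuronSum_const (f : ℝ → ι → ℝ) (b : ℝ) : IsNeuronSum f 0 (fun _ => b) :=
  ⟨Empty, inferInstance, fun _ => 0, 0, 0, b, by simp, fun t => by simp⟩

theorem IsNeuronSum.mono (hg : IsNeuronSum f w g) (hw : w ≤ w') : IsNeuronSum f w' g := by
  obtain ⟨κ, _, q, b, c, e, hκ, hg⟩ := hg
  exact ⟨κ, _, q, b, c, e, hκ.trans hw, hg⟩

theorem IsNeuronSum.add (hg : IsNeuronSum f w g) (hh : IsNeuronSum f w' h) :
    IsNeuronSum f (w + w') (fun t => g t + h t) := by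
  obtain ⟨κ, _, q, b, c, e, hκ, hg⟩ := hg
  obtain ⟨κ', _, q', b', c', e', hκ', hh⟩ := hh
  refine ⟨κ ⊕ κ', inferInstance, Sum.elim q q', Sum.elim b b', Sum.elim c c', e + e', ?_,
    fun t => ?_⟩
  · rw [Fintype.card_sum]
    exact add_le_add hκ hκ'
  · beta_reduce
    rw [hg, hh, Fintype.sum_sum_type]
    simp only [Sum.elim_inl, Sum.elim_inr]
    ring

theorem IsNeuronSum.const_mul (a : ℝ) (hg : IsNeuronSum f w g) :
    IsNeuronSum f w (fun t => a * g t) := by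
  obtain ⟨κ, _, q, b, c, e, hκ, hg⟩ := hg
  refine ⟨κ, _, q, b, a • c, a * e, hκ, fun t => ?_⟩
  beta_reduce
  rw [hg, mul_add, Finset.mul_sum]
  simp [mul_assoc]

theorem isNeuronSum_sum {α : Type*} (S : Finset α) {g : α → ℝ → ℝ}
    (hg : ∀ a ∈ S, IsNeuronSum f w (g a)) :
    IsNeuronSum f (S.card * w) (fun t => ∑ a ∈ S, g a t) := by
  classical
  induction S using Finset.induction_on with
  | empty => simpa using isNeuronSum_const f 0
  | insert a S ha ih =>
    have := (hg a (by simp)).add (ih fun b hb => hg b (by simp [hb]))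
    simp only [Finset.sum_insert ha, Finset.card_insert_of_notMem ha]
    exact this.mono (by linarith)

theorem IsAffineIn.isNeuronSum (hg : IsAffineIn f g) : IsNeuronSum f 2 g := by
  have := hg.relu.add ((hg.const_mul (-1)).relu.const_mul (-1))
  convert this using 2 with t
  rcases le_total (g t) 0 with h | h
  · rw [max_eq_right h, max_eq_left (by linarith)]
    ring
  · rw [max_eq_left h, max_eq_right (by linarith)]
    ring

theorem IsAffineIn.fold (D : ℕ) (hg : IsAffineIn f g) :
    IsNeuronSum f D (fun t => fold D (g t)) := by
  have := isNeuronSum_sum (f := f) (w := 1) (Finset.range D)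
    (g := fun d t => (if d = 0 then 1 else 2 * (-1) ^ d) * max (g t - d) 0)
    (fun d _ => ((hg.sub (isAffineIn_const f d)).relu).const_mul _)
  simpa [_root_.fold] using this

theorem IsWindowCurve.isSupportedCPwL {p L m : ℕ} {B : ℝ → Fin p → ℝ}
    (hB : IsWindowCurve L m B) : IsSupportedCPwL L B := ⟨hB.1, hB.2.1⟩

theorem IsWindowCurve.isNeuronSum {p L m : ℕ} {B : ℝ → Fin p → ℝ} (hB : IsWindowCurve L m B)
    (hg : IsAffineIn f g) (i : Fin p) : IsNeuronSum f (2 + m) (fun t => B (g t) i) := by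
  have hfin := hB.isSupportedCPwL.breakpoints_finite
  obtain ⟨c, v, w, hw⟩ := exists_eq_sum_relu hfin.toFinset hB.1.1
    (fun t ht => notMem_breakpoints.1 (by simpa using ht))
  have hcard : hfin.toFinset.card ≤ m := by
    have := hB.2.2
    rw [hfin.encard_eq_coe_toFinset_card] at this
    exact_mod_cast this
  have := ((hg.const_mul (v i)).add (isAffineIn_const f (c i))).isNeuronSum.add
    (isNeuronSum_sum (f := f) hfin.toFinset (g := fun b t => w b i * max (g t - b) 0)
      (fun b _ => ((hg.sub (isAffineIn_const f b)).relu).const_mul _))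
  convert this.mono (show _ ≤ 2 + m by omega) using 2 with t
  rw [hw]
  simp only [Pi.add_apply, Pi.smul_apply, smul_eq_mul, Finset.sum_apply, mul_comm]
  ring

/-- Scalar functions computed by neurons from a common state are computed together by one layer,
of the width given by the total number of neurons. -/
theorem exists_layer_of_isNeuronSum {κ : Type} [Fintype κ] {F : ℝ → κ → ℝ} {W : ℕ}
    (hF : ∀ k, IsNeuronSum f w (fun t => F t k)) (hW : Fintype.card κ * w ≤ W) :
    ∃ (Q : Matrix (Fin W) ι ℝ) (b : Fin W → ℝ) (C : Matrix κ (Fin W) ℝ) (e : κ → ℝ), ∀ t,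
      F t = C.mulVec (fun i => max ((Q.mulVec (f t) + b) i) 0) + e := by
  classical
  choose σ _ q b c e hσ hF using hF
  have hcard : Fintype.card ((k : κ) × σ k) ≤ Fintype.card (Fin W) := by
    rw [Fintype.card_sigma, Fintype.card_fin]
    refine (Finset.sum_le_sum fun k _ => hσ k).trans ?_
    simpa using hW
  obtain ⟨emb⟩ := Function.Embedding.nonempty_of_card_le hcard
  refine ⟨fun i => Function.extend emb (fun s => q s.1 s.2) 0 i,
    Function.extend emb (fun s => b s.1 s.2) 0,
    fun k i => Function.extend emb (fun s => if s.1 = k then c s.1 s.2 else 0) 0 i, e,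
    fun t => funext fun k => ?_⟩
  refine (hF k t).trans ?_
  rw [Pi.add_apply]
  congr 1
  have hsum := Fintype.sum_of_injective emb emb.injective
    (fun s => (if s.1 = k then c s.1 s.2 else 0) * max (q s.1 s.2 ⬝ᵥ f t + b s.1 s.2) 0)
    (fun i => Function.extend emb (fun s => if s.1 = k then c s.1 s.2 else 0) 0 i *
      max (Function.extend emb (fun s => q s.1 s.2) 0 i ⬝ᵥ f t +
        Function.extend emb (fun s => b s.1 s.2) 0 i) 0)
    (fun i hi => by
      rw [Function.extend_apply' _ _ _ (by simpa using hi)]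
      simp)
    (fun s => by simp only [emb.injective.extend_apply])
  refine Eq.trans ?_ hsum
  rw [Fintype.sum_sigma, Finset.sum_eq_single k (fun k' _ hk' => by simp [hk']) (by simp)]
  simp

end OneLayer

/-! ### States of deep networks -/

/-- The state `f`, a function of the scalar network input, is available after `l` hidden layers of
width `W`: any further layer of width `W` fed with `f` is the state of hidden layer `l + 1` of a
network. In this form the affine map that reads `f` off the last hidden layer is merged into the
next layer, and `l = 0` describes the network input. -/
def IsState {ι : Type} [Fintype ι] (W l : ℕ) (f : ℝ → ι → ℝ) : Prop :=
  ∀ (Q : Matrix (Fin W) ι ℝ) (b : Fin W → ℝ),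
    IsHiddenState 1 W (l + 1) (fun x i => max ((Q.mulVec (f (x 0)) + b) i) 0)

section State

variable {ι κ : Type} [Fintype ι] [Fintype κ] {f : ℝ → ι → ℝ} {W l w : ℕ}

theorem isState_input (W : ℕ) : IsState W 0 (fun t (_ : Fin 1) => t) := by
  intro Q b
  convert IsHiddenState.first Q b using 1
  funext x
  have : (fun _ : Fin 1 => x 0) = x := funext fun i => by rw [Subsingleton.elim i 0]
  simp only [this]
  rfl

theorem IsState.next (hf : IsState W l f) {g : ℝ → κ → ℝ}
    (hg : ∀ k, IsNeuronSum f w (fun t => g t k)) (hW : Fintype.card κ * w ≤ W) :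
    IsState W (l + 1) g := by
  obtain ⟨Q, b, C, e, hg⟩ := exists_layer_of_isNeuronSum hg hW
  intro Q' b'
  convert IsHiddenState.next (Q' * C) (Q'.mulVec e + b') (hf Q b) using 1
  funext x
  funext i
  simp only [reluLayer]
  rw [hg, Matrix.mulVec_add, Matrix.mulVec_mulVec, add_assoc]

theorem IsState.mem_upsilon {N : ℕ} (hf : IsState W l f) {g : ℝ → Fin N → ℝ}
    (hg : ∀ k, IsNeuronSum f w (fun t => g t k)) (hW : N * w ≤ W) :
    (fun x : Fin 1 → ℝ => g (x 0)) ∈ Upsilon W (l + 1) 1 N := by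
  obtain ⟨Q, b, C, e, hg⟩ := exists_layer_of_isNeuronSum hg (by simpa using hW)
  exact ⟨_, hf Q b, C, e, fun x => hg (x 0)⟩

theorem IsState.mono_depth {l' : ℕ} (hf : IsState W l f) (hW : Fintype.card ι * 2 ≤ W)
    (hl : l ≤ l') : IsState W l' f := by
  induction l', hl using Nat.le_induction with
  | base => exact hf
  | succ l' _ ih => exact ih.next (fun k => (isAffineIn_coord f k).isNeuronSum) hW

end State

/-! ### The sheets of a curve over the unit interval -/

/-- The sign `1` or `-1` encoded by a Boolean. -/
def sgn (ε : Bool) : ℤ := if ε then 1 else -1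

theorem sgn_not (ε : Bool) : sgn (!ε) = -sgn ε := by cases ε <;> rfl

/-- The values of a curve at the points `c + z` and `c - z`, `0 ≤ c ≤ L`. For `z ∈ [0, 1]` a
curve supported in `[0, L]` vanishes at the points `c + z` and `c - z` for every other
integer `c`. -/
def sheets {p : ℕ} (L : ℕ) (F : ℝ → Fin p → ℝ) (z : ℝ) : Fin (L + 1) × Bool × Fin p → ℝ :=
  fun a => F ((a.1 : ℕ) + sgn a.2.1 * z) a.2.2

section Sheets

variable {ι : Type} [Fintype ι] {f : ℝ → ι → ℝ} {p L M : ℕ} {F : ℝ → Fin p → ℝ}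

theorem isAffineIn_of_sheets (hF : IsSupportedCPwL L F) {z : ℝ → ℝ}
    (hz : ∀ t, z t ∈ Icc (0 : ℝ) 1) (hs : ∀ a, IsAffineIn f (fun t => sheets L F (z t) a))
    (c : ℤ) (ε : Bool) (i : Fin p) : IsAffineIn f (fun t => F (c + sgn ε * z t) i) := by
  have hbd : ∀ t, |(sgn ε : ℝ) * z t| ≤ 1 := fun t => by
    have := hz t
    cases ε <;> simp [sgn, abs_le] <;> constructor <;> linarith [this.1, this.2]
  rcases lt_or_ge c 0 with hc | hc
  · have hc' : (c : ℝ) + 1 ≤ 0 := by exact_mod_cast hc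
    convert isAffineIn_const f 0 using 2 with t
    rw [hF.eq_zero (Or.inl (by linarith [(abs_le.1 (hbd t)).2]))]
    rfl
  rcases lt_or_ge (L : ℤ) c with hc' | hc'
  · have hc'' : (L : ℝ) + 1 ≤ c := by exact_mod_cast hc'
    convert isAffineIn_const f 0 using 2 with t
    rw [hF.eq_zero (Or.inr (by linarith [(abs_le.1 (hbd t)).1]))]
    rfl
  · lift c to ℕ using hc
    exact hs (⟨c, by omega⟩, ε, i)

/-- One layer recovers a curve at `c ± x`, where `x` ranges over `[0, D]`, from `x` and the sheets
of the curve over the folded point. -/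
theorem isNeuronSum_of_sheets_fold (hF : IsSupportedCPwL L F) {D : ℕ} (hD : 1 ≤ D) {x : ℝ → ℝ}
    (hx : IsAffineIn f x) (hxD : ∀ t, x t ∈ Icc (0 : ℝ) D)
    (hs : ∀ a, IsAffineIn f (fun t => sheets L F (fold D (x t)) a))
    (c : ℤ) (ε : Bool) (i : Fin p) :
    IsNeuronSum f (2 * D) (fun t => F (c + sgn ε * x t) i) := by
  obtain ⟨K, hK, hlip⟩ := hF.exists_lipschitz i
  have hφ : ∀ s t : ℝ, |F (c + sgn ε * s) i - F (c + sgn ε * t) i| ≤ K * |s - t| := by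
    intro s t
    refine (hlip _ _).trans (le_of_eq ?_)
    rw [add_sub_add_left_eq_sub, ← mul_sub, abs_mul]
    cases ε <;> simp [sgn]
  have hbranch : ∀ d : ℕ,
      IsAffineIn f (fun t => F (c + sgn ε * unfoldBranch d (fold D (x t))) i) := by
    intro d
    by_cases hd : Even d
    · have harg : ∀ z : ℝ, (c : ℝ) + sgn ε * unfoldBranch d z =
          ((c + sgn ε * d : ℤ) : ℝ) + sgn ε * z := fun z => by
        rw [unfoldBranch, if_pos hd]
        push_cast
        ring
      simp only [harg]
      exact isAffineIn_of_sheets hF (fun t => fold_mem hD (hxD t)) hs _ ε i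
    · have harg : ∀ z : ℝ, (c : ℝ) + sgn ε * unfoldBranch d z =
          ((c + sgn ε * (d + 1) : ℤ) : ℝ) + sgn (!ε) * z := fun z => by
        rw [unfoldBranch, if_neg hd, sgn_not]
        push_cast
        ring
      simp only [harg]
      exact isAffineIn_of_sheets hF (fun t => fold_mem hD (hxD t)) hs _ (!ε) i
  have hu : ∀ d : ℕ, IsAffineIn f (fun t => x t - (d + 1)) := fun d =>
    hx.sub (isAffineIn_const f _)
  have hsum := (hbranch 0).isNeuronSum.add (isNeuronSum_sum (f := f) (Finset.range (D - 1))
    fun d _ => ((((hu d).const_mul (2 * K)).add ((hbranch (d + 1)).sub (hbranch d))).relu).add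
      ((hu d).relu.const_mul (-(2 * K))))
  rw [Finset.card_range] at hsum
  convert hsum.mono (show _ ≤ 2 * D by omega) using 2 with t
  exact eq_add_sum_select hK hφ hD (hxD t)

/-- Only boundedly many shifts contribute to the refinement of a curve supported in `[0, L]` at
the points `c ± s`, `s ∈ [0, 1]`, however large the support of the mask is. -/
theorem refinementOp_apply_eq_sum (hF : IsSupportedCPwL L F)
    (A : ℤ →₀ Matrix (Fin p) (Fin p) ℝ) {s : ℝ} (hs : s ∈ Icc (0 : ℝ) 1) (c : ℤ) (ε : Bool)
    (i : Fin p) :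
    refinementOp M A F (c + sgn ε * s) i = ∑ c' ∈ Finset.Icc (-M : ℤ) (L + M),
      ∑ j, A (M * c - c') i j * F (c' + sgn ε * (M * s)) j := by
  have hMs : |(sgn ε : ℝ) * (M * s)| ≤ M := by
    rw [abs_mul, abs_of_nonneg (mul_nonneg (Nat.cast_nonneg M) hs.1)]
    have : (M : ℝ) * s ≤ M := mul_le_of_le_one_right (Nat.cast_nonneg M) hs.2
    cases ε <;> simpa [sgn] using this
  rw [refinementOp, Finset.sum_apply]
  -- Reindexing by `c' = M c - j`: outside `[-M, L + M]` the argument of `F` misses `(0, L)`.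
  refine Finset.sum_bij_ne_zero (fun j _ _ => M * c - j) ?_ ?_ ?_ ?_
  · intro j _ hne
    rw [Finset.mem_Icc]
    by_contra hcon
    apply hne
    have harg : (M : ℝ) * (c + sgn ε * s) - j = ((M * c - j : ℤ) : ℝ) + sgn ε * (M * s) := by
      push_cast
      ring
    rw [harg, hF.eq_zero, Matrix.mulVec_zero, Pi.zero_apply]
    rcases not_and_or.1 hcon with h | h
    · left
      have : ((M * c - j : ℤ) : ℝ) ≤ -M := by exact_mod_cast (not_le.1 h).le
      linarith [(abs_le.1 hMs).2]
    · right
      have : (L : ℝ) + M ≤ ((M * c - j : ℤ) : ℝ) := by exact_mod_cast (not_le.1 h).le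
      linarith [(abs_le.1 hMs).1]
  · intro j _ _ j' _ _ h
    linarith
  · intro c' _ hne
    refine ⟨M * c - c', ?_, ?_, by ring⟩
    · rw [Finsupp.mem_support_iff]
      intro h
      exact hne (by simp [h])
    · convert hne using 1
      rw [Matrix.mulVec, dotProduct]
      refine Finset.sum_congr rfl fun j _ => ?_
      congr 3
      push_cast
      ring
  · intro j _ _
    rw [Matrix.mulVec, dotProduct, sub_sub_cancel]
    refine Finset.sum_congr rfl fun k _ => ?_
    congr 3
    push_cast
    ring

/-- One layer computes the sheets of a refined curve over `s` from `s` and the sheets of the curve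
over the folded point `fold M (M s)`. -/
theorem isNeuronSum_sheets_forcedRefine {N : ℕ} (hM : 1 ≤ M) (hF : IsSupportedCPwL L F)
    {B : ℝ → Fin p → ℝ} (hB : IsWindowCurve L N B) (A : ℤ →₀ Matrix (Fin p) (Fin p) ℝ)
    {s : ℝ → ℝ} (hs : IsAffineIn f s) (hs01 : ∀ t, s t ∈ Icc (0 : ℝ) 1)
    (hy : ∀ a, IsAffineIn f (fun t => sheets L F (fold M (M * s t)) a))
    (a : Fin (L + 1) × Bool × Fin p) :
    IsNeuronSum f ((L + 2 * M + 1) * (p * (2 * M)) + (2 + N))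
      (fun t => sheets L (forcedRefine M A B F) (s t) a) := by
  obtain ⟨c, ε, i⟩ := a
  have hMs : ∀ t, (M : ℝ) * s t ∈ Icc (0 : ℝ) M := fun t =>
    ⟨mul_nonneg (Nat.cast_nonneg M) (hs01 t).1,
      mul_le_of_le_one_right (Nat.cast_nonneg M) (hs01 t).2⟩
  have hV := isNeuronSum_sum (f := f) (Finset.Icc (-M : ℤ) (L + M)) fun c' _ =>
    isNeuronSum_sum (f := f) Finset.univ fun j _ =>
      (isNeuronSum_of_sheets_fold hF hM (hs.const_mul M) hMs hy c' ε j).const_mul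
        (A (M * (c : ℕ) - c') i j)
  have hBs := hB.isNeuronSum
    ((isAffineIn_const f ((c : ℕ) : ℝ)).add (hs.const_mul (sgn ε : ℝ))) i
  rw [Int.card_Icc, Finset.card_univ, Fintype.card_fin,
    show (L + M + 1 - -M : ℤ).toNat = L + 2 * M + 1 by omega] at hV
  convert hV.add hBs using 2 with t
  have := refinementOp_apply_eq_sum (M := M) hF A (hs01 t) (c : ℕ) ε i
  rw [Int.cast_natCast] at this
  rw [sheets, forcedRefine, Pi.add_apply, Pi.add_apply, this]

end Sheets

/-! ### The network for an iterated refinement -/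

/-- The foldResidual after `j` refinement steps of the folded point `fold L x`. -/
noncomputable def foldResidual (M L : ℕ) (x : ℝ) (j : ℕ) : ℝ :=
  (fun s => fold M (M * s))^[j] (fold L x)

theorem foldResidual_succ (M L : ℕ) (x : ℝ) (j : ℕ) :
    foldResidual M L x (j + 1) = fold M (M * foldResidual M L x j) :=
  Function.iterate_succ_apply' _ _ _

theorem foldResidual_mem {M L : ℕ} (hM : 1 ≤ M) (hL : 1 ≤ L) {x : ℝ}
    (hx : x ∈ Icc (0 : ℝ) L) (j : ℕ) :
    foldResidual M L x j ∈ Icc (0 : ℝ) 1 := by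
  induction j with
  | zero => exact fold_mem hL hx
  | succ j ih =>
    rw [foldResidual_succ]
    exact fold_mem hM ⟨mul_nonneg (Nat.cast_nonneg M) ih.1,
      mul_le_of_le_one_right (Nat.cast_nonneg M) ih.2⟩

/-- The projection of the line onto `[0, L]`. -/
noncomputable def clamp (L : ℕ) (t : ℝ) : ℝ := max t 0 + -1 * max (t - L) 0

theorem clamp_mem (L : ℕ) (t : ℝ) : clamp L t ∈ Icc (0 : ℝ) L := by
  have hL : (0 : ℝ) ≤ L := Nat.cast_nonneg L
  rw [clamp]
  rcases le_total t 0 with h | h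
  · rw [max_eq_right h, max_eq_right (by linarith)]
    constructor <;> linarith
  · rcases le_total t L with h' | h'
    · rw [max_eq_left h, max_eq_right (by linarith)]
      constructor <;> linarith
    · rw [max_eq_left h, max_eq_left (by linarith)]
      constructor <;> linarith

theorem IsSupportedCPwL.apply_clamp {p L : ℕ} {F : ℝ → Fin p → ℝ} (hF : IsSupportedCPwL L F)
    (t : ℝ) : F (clamp L t) = F t := by
  have hL : (0 : ℝ) ≤ L := Nat.cast_nonneg L
  rcases le_total t 0 with h | h
  · rw [hF.eq_zero (Or.inl h), clamp, max_eq_right h, max_eq_right (by linarith)]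
    exact hF.eq_zero (Or.inl (by linarith))
  · rcases le_total t L with h' | h'
    · rw [clamp, max_eq_left h, max_eq_right (by linarith)]
      congr 1
      ring
    · rw [hF.eq_zero (Or.inr h'), clamp, max_eq_left h, max_eq_left (by linarith)]
      exact hF.eq_zero (Or.inr (by linarith))

/-- A number of neurons that suffices for every scalar function occurring in the network. -/
def neuronBound (M p L N : ℕ) : ℕ :=
  (L + 2 * M + 1) * (p * (2 * M)) + (2 + N) + 2 * L + M

/-- The width of the network: `neuronBound` neurons for each coordinate of its largest state. -/
def netWidth (M p L N : ℕ) : ℕ :=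
  (2 + (L + 1) * (2 * p)) * neuronBound M p L N

section Iterate

variable {M p L N : ℕ} {A : ℤ →₀ Matrix (Fin p) (Fin p) ℝ} {B G : ℕ → ℝ → Fin p → ℝ}

/-- One refinement step: given the sheets of `F` over the residual of order `j + 1`, the network
recomputes the residual of order `j` from the stored input in `j + 1` layers, and one further
layer produces the sheets of the refined curve over it. -/
theorem IsState.refine (hM : 1 ≤ M) (hL : 1 ≤ L)
    {F B : ℝ → Fin p → ℝ} (hF : IsSupportedCPwL L F) (hB : IsWindowCurve L N B) {l : ℕ} (j : ℕ)
    (h : IsState (netWidth M p L N) l (fun t => Sum.elim (fun _ : Fin 1 => clamp L t)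
      (sheets L F (foldResidual M L (clamp L t) (j + 1))))) :
    IsState (netWidth M p L N) (l + j + 2) (fun t => Sum.elim (fun _ : Fin 1 => clamp L t)
      (sheets L (forcedRefine M A B F) (foldResidual M L (clamp L t) j))) := by
  have hw2 : 2 ≤ neuronBound M p L N := by unfold neuronBound; omega
  have hwL : L ≤ neuronBound M p L N := by unfold neuronBound; omega
  have hwM : M ≤ neuronBound M p L N := by unfold neuronBound; omega
  have key : ∀ r, IsState (netWidth M p L N) (l + r + 1) (fun t =>
      Sum.elim ![clamp L t, foldResidual M L (clamp L t) r]
        (sheets L F (foldResidual M L (clamp L t) (j + 1)))) := by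
    intro r
    induction r with
    | zero =>
      refine h.next (w := neuronBound M p L N) ?_ (by simp [netWidth])
      rintro (k | a)
      · fin_cases k
        · exact (isAffineIn_coord _ (Sum.inl 0)).isNeuronSum.mono hw2
        · exact ((isAffineIn_coord _ (Sum.inl 0)).fold L).mono hwL
      · exact (isAffineIn_coord _ (Sum.inr a)).isNeuronSum.mono hw2
    | succ r ih =>
      refine ih.next (w := neuronBound M p L N) ?_ (by simp [netWidth])
      rintro (k | a)
      · fin_cases k
        · exact (isAffineIn_coord _ (Sum.inl 0)).isNeuronSum.mono hw2
        · simp only [foldResidual_succ]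
          exact (((isAffineIn_coord _ (Sum.inl 1)).const_mul M).fold M).mono hwM
      · exact (isAffineIn_coord _ (Sum.inr a)).isNeuronSum.mono hw2
  refine (key j).next (w := neuronBound M p L N) ?_ ?_
  · rintro (k | a)
    · exact (isAffineIn_coord _ (Sum.inl 0)).isNeuronSum.mono hw2
    · refine (isNeuronSum_sheets_forcedRefine hM hF hB A (isAffineIn_coord _ (Sum.inl 1))
        (fun t => foldResidual_mem hM hL (clamp_mem L t) j) (fun a => ?_) a).mono
        (by unfold neuronBound; omega)
      have := isAffineIn_coord (fun t => Sum.elim ![clamp L t, foldResidual M L (clamp L t) j]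
        (sheets L F (foldResidual M L (clamp L t) (j + 1)))) (Sum.inr a)
      simp only [foldResidual_succ] at this ⊢
      exact this
  · simp [netWidth]
    gcongr
    omega

theorem isSupportedCPwL_iterate (hM : 1 ≤ M) (hA : PreservesWindow M A L)
    (hB : ∀ i, IsWindowCurve L N (B i)) (h0 : G 0 = 0)
    (hG : ∀ i, G (i + 1) = forcedRefine M A (B i) (G i)) (i : ℕ) : IsSupportedCPwL L (G i) := by
  induction i with
  | zero => exact h0 ▸ IsSupportedCPwL.zero L
  | succ i ih =>
    rw [hG]
    exact isSupportedCPwL_forcedRefine hM hA (hB i).isSupportedCPwL ih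

/-- The iterates from the zero curve are computed in quadratic depth: one layer for `clamp`, at most
`n + 1` layers for each of the `n` refinement steps, and one layer that reads the curve off its
sheets over the folded input. -/
theorem mem_upsilon_iterate (hM : 1 ≤ M) (hL : 1 ≤ L) (hA : PreservesWindow M A L)
    (hB : ∀ i, IsWindowCurve L N (B i)) (h0 : G 0 = 0)
    (hG : ∀ i, G (i + 1) = forcedRefine M A (B i) (G i)) (n D : ℕ)
    (hD : n * (n + 1) + 2 ≤ D) :
    (fun x : Fin 1 → ℝ => G n (x 0)) ∈ Upsilon (netWidth M p L N) D 1 p := by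
  have hsupp := isSupportedCPwL_iterate hM hA hB h0 hG
  have hw2 : 2 ≤ neuronBound M p L N := by unfold neuronBound; omega
  have hwL : 2 * L ≤ neuronBound M p L N := by unfold neuronBound; omega
  have hcard : Fintype.card (Fin 1 ⊕ Fin (L + 1) × Bool × Fin p) * neuronBound M p L N ≤
      netWidth M p L N := by
    simp [netWidth]
    gcongr
    omega
  have hpad : Fintype.card (Fin 1 ⊕ Fin (L + 1) × Bool × Fin p) * 2 ≤ netWidth M p L N :=
    (Nat.mul_le_mul_left _ hw2).trans hcard
  have hstate : ∀ i ≤ n, IsState (netWidth M p L N) (i * (n + 1) + 1) (fun t =>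
      Sum.elim (fun _ : Fin 1 => clamp L t)
        (sheets L (G i) (foldResidual M L (clamp L t) (n - i)))) := by
    intro i
    induction i with
    | zero =>
      intro _
      rw [zero_mul]
      refine (isState_input _).next (w := neuronBound M p L N) ?_ hcard
      rintro (k | a)
      · refine IsNeuronSum.mono ?_ hw2
        exact (isAffineIn_coord _ 0).relu.add
          (((isAffineIn_coord _ 0).sub (isAffineIn_const _ (L : ℝ))).relu.const_mul (-1))
      · have h := (isNeuronSum_const (fun t (_ : Fin 1) => t) 0).mono
          (Nat.zero_le (neuronBound M p L N))
        simpa [sheets, h0] using h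
    | succ i ih =>
      intro hi
      have h := ih (by omega)
      rw [show n - i = n - (i + 1) + 1 by omega] at h
      rw [hG]
      refine (h.refine hM hL (hsupp i) (hB i)).mono_depth hpad ?_
      rw [add_mul]
      omega
  have hlast := hstate n le_rfl
  rw [Nat.sub_self] at hlast
  obtain ⟨D, rfl⟩ : ∃ D', D = D' + 1 := ⟨D - 1, by omega⟩
  refine (hlast.mono_depth hpad (show _ ≤ D by omega)).mem_upsilon (w := neuronBound M p L N)
    (fun i => ?_) ?_
  · have := isNeuronSum_of_sheets_fold (hsupp n) hL (isAffineIn_coord (fun t =>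
      Sum.elim (fun _ : Fin 1 => clamp L t) (sheets L (G n) (foldResidual M L (clamp L t) 0)))
      (Sum.inl 0)) (fun t => clamp_mem L t) (fun a => isAffineIn_coord _ (Sum.inr a)) 0 true i
    convert this.mono hwL using 2 with t
    simp [sgn, (hsupp n).apply_clamp]
  · unfold netWidth
    gcongr
    nlinarith

end Iterate

theorem IsWindowCurve.mono {p L m m' : ℕ} {f : ℝ → Fin p → ℝ} (hf : IsWindowCurve L m f)
    (h : m ≤ m') : IsWindowCurve L m' f :=
  ⟨hf.1, hf.2.1, hf.2.2.trans (by exact_mod_cast h)⟩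

theorem refinementOp_zero {p M : ℕ} (A : ℤ →₀ Matrix (Fin p) (Fin p) ℝ) :
    refinementOp M A 0 = 0 := by
  ext t i
  simp [refinementOp]

theorem mainTheorem2 (M p L : ℕ) (hM : 2 ≤ M) (hp : 1 ≤ p) (hL : 1 ≤ L) (k m : ℕ) :
    ∃ C₀ C₁ : ℕ, 0 < C₀ ∧ 0 < C₁ ∧
      ∀ (A : ℤ →₀ Matrix (Fin p) (Fin p) ℝ), PreservesWindow M A L →
      ∀ (γ : ℝ → Fin p → ℝ), IsWindowCurve L k γ →
        (∀ (B : ℕ → ℝ → Fin p → ℝ), (∀ r, IsWindowCurve L m (B r)) →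
          ∀ n : ℕ, 1 ≤ n →
            (fun x : Fin 1 → ℝ => stageIterate (fun r => forcedRefine M A (B r)) γ n (x 0)) ∈
              Upsilon C₀ (C₁ * n ^ 2) 1 p) ∧
        (∀ (B : ℝ → Fin p → ℝ), IsWindowCurve L m B →
          ∀ n : ℕ, 1 ≤ n →
            (fun x : Fin 1 → ℝ => ((forcedRefine M A B)^[n] γ) (x 0)) ∈
              Upsilon C₀ (C₁ * n ^ 2) 1 p) := by
  refine ⟨netWidth M p L (max k m), 8, ?_, by norm_num, fun A hA γ hγ => ?_⟩
  · unfold netWidth neuronBound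
    positivity
  have hstage : ∀ (B : ℕ → ℝ → Fin p → ℝ), (∀ r, IsWindowCurve L m (B r)) → ∀ n : ℕ, 1 ≤ n →
      (fun x : Fin 1 → ℝ => stageIterate (fun r => forcedRefine M A (B r)) γ n (x 0)) ∈
        Upsilon (netWidth M p L (max k m)) (8 * n ^ 2) 1 p := by
    intro B hB n hn
    -- The initial curve is the forcing term of an additional first step applied to the zero curve.
    -- It has `n + 1` steps, and `(n + 1) (n + 2) + 2 ≤ 8 n ^ 2` for `n ≥ 1`.
    refine mem_upsilon_iterate (by omega) hL hA (B := fun i => Nat.casesOn i γ B)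
      (G := fun i => Nat.casesOn i 0 (stageIterate (fun r => forcedRefine M A (B r)) γ))
      (fun i => ?_) rfl (fun i => ?_) (n + 1) (8 * n ^ 2) (by nlinarith)
    · cases i with
      | zero => exact hγ.mono (le_max_left _ _)
      | succ i => exact (hB i).mono (le_max_right _ _)
    · cases i with
      | zero => simp [forcedRefine, refinementOp_zero, stageIterate]
      | succ i => rfl
  refine ⟨hstage, fun B hB n hn => ?_⟩
  have hiter : ∀ n,
      (forcedRefine M A B)^[n] γ = stageIterate (fun _ => forcedRefine M A B) γ n := by
    intro n
    induction n with
    | zero => rfl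
    | succ n ih => rw [Function.iterate_succ_apply', ih, stageIterate]
  simpa only [hiter] using hstage (fun _ => B) (fun _ => hB) n hn
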